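/- Let $(M,g)$ be an $n$-dimensional (smooth) Riemannian manifold with Ricci tensor $S$, let $f\in C^\infty(M)$, $\xi=\operatorname{grad} f$, $\eta=\xi^\flat=df$, and let $\lambda,\mu\in\mathbb{R}$. Suppose that $(g,\xi,\lambda,\mu)$ is a gradient $\eta$-Ricci soliton, that is, $$L_\xi g+2S+2\lambda g+2\mu\,\eta\otimes\eta=0,$$ and that the $1$-form $\eta$ is harmonic, in the sense that it is closed and divergence free (for $\eta=df$: $\Delta f=0$). Then, on $M$, $$\tfrac12\,\Delta_f(|\xi|^2)=|\operatorname{Hess} f|^2+\lambda|\xi|^2+\mu|\xi|^4,$$ where $\Delta=\operatorname{div}\operatorname{grad}$ is the Laplacian on functions and $\Delta_f u=\Delta u-\nabla_{\operatorname{grad} f}u=\Delta u-g(\operatorname{grad} f,\operatorname{grad} u)$. -/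

import Mathlib

open scoped Manifold ContDiff Bundle

noncomputable section

namespace EtaRicci

/-- The model space `ℝⁿ`. -/
abbrev Model (n : ℕ) : Type := EuclideanSpace ℝ (Fin n)

/-! ## Riemannian geometry in local coordinates

Here `G y = (g_ij(y))` is the matrix of a metric at the point with coordinates `y`,
and `(G y)⁻¹ = (g^ij(y))`. -/

section Coordinates

variable {n : ℕ}

/-- The partial derivative `∂_i u`. -/
def pd (i : Fin n) (u : Model n → ℝ) (y : Model n) : ℝ :=
  fderiv ℝ u y (EuclideanSpace.single i 1)

/-- The Christoffel symbol `Γ^k_ij = ½ g^kl (∂_i g_jl + ∂_j g_il - ∂_l g_ij)`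
of the Levi-Civita connection. -/
def christoffel (G : Model n → Matrix (Fin n) (Fin n) ℝ) (k i j : Fin n) (y : Model n) : ℝ :=
  (1 / 2) * ∑ l, (G y)⁻¹ k l *
    (pd i (fun z => G z j l) y + pd j (fun z => G z i l) y - pd l (fun z => G z i j) y)

/-- The Ricci tensor
`S_ij = ∂_k Γ^k_ij - ∂_i Γ^k_kj + Γ^k_kl Γ^l_ij - Γ^k_il Γ^l_kj`
(positive on round spheres). -/
def coordRicci (G : Model n → Matrix (Fin n) (Fin n) ℝ) (i j : Fin n) (y : Model n) : ℝ :=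
  ∑ k, (pd k (christoffel G k i j) y - pd i (christoffel G k k j) y) +
  ∑ k, ∑ l, (christoffel G k k l y * christoffel G l i j y -
    christoffel G k i l y * christoffel G l k j y)

/-- The covariant derivative of a 1-form: `(∇a)_ij = ∇_i a_j = ∂_i a_j - Γ^k_ij a_k`. -/
def coordNabla (G : Model n → Matrix (Fin n) (Fin n) ℝ) (a : Fin n → Model n → ℝ)
    (i j : Fin n) (y : Model n) : ℝ :=
  pd i (a j) y - ∑ k, christoffel G k i j y * a k y

/-- The divergence `g^ij ∇_i a_j` of (the vector field dual to) a 1-form. -/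
def coordDiv (G : Model n → Matrix (Fin n) (Fin n) ℝ) (a : Fin n → Model n → ℝ)
    (y : Model n) : ℝ :=
  ∑ i, ∑ j, (G y)⁻¹ i j * coordNabla G a i j y

/-- The Hessian `Hess u = ∇du`. -/
def coordHess (G : Model n → Matrix (Fin n) (Fin n) ℝ) (u : Model n → ℝ)
    (i j : Fin n) (y : Model n) : ℝ :=
  coordNabla G (fun k => pd k u) i j y

/-- The Laplacian `Δu = div (grad u) = g^ij (Hess u)_ij`. -/
def coordLaplacian (G : Model n → Matrix (Fin n) (Fin n) ℝ) (u : Model n → ℝ)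
    (y : Model n) : ℝ :=
  coordDiv G (fun k => pd k u) y

/-- The Lie derivative of the metric:
`(L_X g)_ij = X^k ∂_k g_ij + g_kj ∂_i X^k + g_ik ∂_j X^k`. -/
def coordLieMetric (G : Model n → Matrix (Fin n) (Fin n) ℝ) (X : Fin n → Model n → ℝ)
    (i j : Fin n) (y : Model n) : ℝ :=
  ∑ k, (X k y * pd k (fun z => G z i j) y + G y k j * pd i (X k) y + G y i k * pd j (X k) y)

/-- The squared norm `g^ik g^jl T_ij T_kl` of a `(0,2)`-tensor, for a metric matrix `A`. -/
def coordTensorNormSq (A : Matrix (Fin n) (Fin n) ℝ) (T : Fin n → Fin n → ℝ) : ℝ :=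
  ∑ i, ∑ j, ∑ k, ∑ l, A⁻¹ i k * A⁻¹ j l * T i j * T k l

end Coordinates

/-! ## Riemannian manifolds -/

section Manifolds

variable {n : ℕ} {M : Type*} [TopologicalSpace M] [ChartedSpace (Model n) M]

/-- The coordinate vector `∂_i` of the chart `e`, at the point with coordinates `y`. -/
def frame (e : OpenPartialHomeomorph M (Model n)) (i : Fin n) (y : Model n) :
    TangentSpace (𝓡 n) (e.symm y) :=
  mfderiv (𝓡 n) (𝓡 n) e.symm y (EuclideanSpace.single i (1 : ℝ) : Model n)

/-- The components `γ_i = γ(∂_i)` of a 1-form in the chart `e`. -/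
def formIn (γ : ∀ p : M, TangentSpace (𝓡 n) p →L[ℝ] ℝ) (e : OpenPartialHomeomorph M (Model n))
    (i : Fin n) (y : Model n) : ℝ :=
  γ (e.symm y) (frame e i y)

/-- The components `ξ^i = dx^i(ξ)` of a vector field in the chart `e`. -/
def fieldIn (ξ : ∀ p : M, TangentSpace (𝓡 n) p) (e : OpenPartialHomeomorph M (Model n))
    (i : Fin n) (y : Model n) : ℝ :=
  (EuclideanSpace.proj i : Model n →L[ℝ] ℝ) (mfderiv (𝓡 n) (𝓡 n) e (e.symm y) (ξ (e.symm y)))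

variable [IsManifold (𝓡 n) ∞ M]

/-- A smooth Riemannian metric on the manifold `M`. -/
abbrev Metric (n : ℕ) (M : Type*) [TopologicalSpace M] [ChartedSpace (Model n) M]
    [IsManifold (𝓡 n) ∞ M] :=
  Bundle.ContMDiffRiemannianMetric (𝓡 n) ∞ (Model n) (fun p : M => TangentSpace (𝓡 n) p)

/-- The matrix `g_ij = g(∂_i, ∂_j)` of the metric in the chart `e`. -/
def metricIn (g : Metric n M) (e : OpenPartialHomeomorph M (Model n)) (y : Model n) :
    Matrix (Fin n) (Fin n) ℝ :=
  Matrix.of fun i j => g.inner (e.symm y) (frame e i y) (frame e j y)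

/-- The 1-form `ξ^♭ = g(ξ, ·)` dual to a vector field. -/
def flat (g : Metric n M) (ξ : ∀ p : M, TangentSpace (𝓡 n) p) (p : M) :
    TangentSpace (𝓡 n) p →L[ℝ] ℝ :=
  g.inner p (ξ p)

/-- The metric at `p` as a bilinear form on the tangent space. -/
def bilin (g : Metric n M) (p : M) : LinearMap.BilinForm ℝ (TangentSpace (𝓡 n) p) :=
  LinearMap.mk₂ ℝ (fun v w => g.inner p v w) (by simp) (by simp) (by simp) (by simp)

instance instFiniteDimensionalTangent (p : M) : FiniteDimensional ℝ (TangentSpace (𝓡 n) p) :=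
  inferInstanceAs (FiniteDimensional ℝ (Model n))

theorem bilin_nondegenerate (g : Metric n M) (p : M) : (bilin g p).Nondegenerate := by
  constructor
  · intro v hv
    by_contra h
    exact (g.pos p v h).ne' (hv v)
  · intro v hv
    by_contra h
    exact (g.pos p v h).ne' (hv v)

/-- The differential `df`, a 1-form. -/
def differential (f : M → ℝ) (p : M) : TangentSpace (𝓡 n) p →L[ℝ] ℝ :=
  (mfderiv (𝓡 n) 𝓘(ℝ, ℝ) f p : TangentSpace (𝓡 n) p →L[ℝ] ℝ)

/-- The gradient of `f`: the vector field with `g(grad f, w) = df(w)`. -/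
def grad (g : Metric n M) (f : M → ℝ) (p : M) : TangentSpace (𝓡 n) p :=
  (LinearMap.BilinForm.toDual (bilin g p) (bilin_nondegenerate g p)).symm
    (differential f p).toLinearMap

theorem inner_grad (g : Metric n M) (f : M → ℝ) (p : M) (w : TangentSpace (𝓡 n) p) :
    g.inner p (grad g f p) w = differential f p w :=
  LinearMap.BilinForm.apply_toDual_symm_apply (B := bilin g p)
    (hB := bilin_nondegenerate g p) (differential f p).toLinearMap w

theorem flat_grad (g : Metric n M) (f : M → ℝ) : flat g (grad g f) = differential f := by
  funext p
  ext w
  exact inner_grad g f p w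

/-- `|ξ|² = g(ξ, ξ)`. -/
def normSq (g : Metric n M) (ξ : ∀ p : M, TangentSpace (𝓡 n) p) (p : M) : ℝ :=
  g.inner p (ξ p) (ξ p)

/-- `(g, ξ, λ, μ)` is an `η`-Ricci soliton: with `η = ξ^♭`, the tensor equation
`L_ξ g + 2 S + 2 λ g + 2 μ η ⊗ η = 0` holds on `M`, i.e. in all local coordinates. -/
def IsEtaRicciSoliton (g : Metric n M) (ξ : ∀ p : M, TangentSpace (𝓡 n) p) (lam mu : ℝ) : Prop :=
  ∀ e ∈ IsManifold.maximalAtlas (𝓡 n) ∞ M, ∀ y ∈ e.target, ∀ i j : Fin n,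
    coordLieMetric (metricIn g e) (fieldIn ξ e) i j y + 2 * coordRicci (metricIn g e) i j y +
      2 * lam * metricIn g e y i j +
      2 * mu * (formIn (flat g ξ) e i y * formIn (flat g ξ) e j y) = 0

/-- The 1-form `γ` is harmonic: closed (`∂_i γ_j = ∂_j γ_i`) and divergence free, in all
local coordinates. -/
def IsHarmonicForm (g : Metric n M) (γ : ∀ p : M, TangentSpace (𝓡 n) p →L[ℝ] ℝ) : Prop :=
  ∀ e ∈ IsManifold.maximalAtlas (𝓡 n) ∞ M, ∀ y ∈ e.target,
    (∀ i j : Fin n, pd i (formIn γ e j) y = pd j (formIn γ e i) y) ∧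
    coordDiv (metricIn g e) (formIn γ e) y = 0

/-- The Laplacian `Δu = div (grad u)` at `p`, computed in the chart `e` around `p`. -/
def laplacian (g : Metric n M) (e : OpenPartialHomeomorph M (Model n)) (u : M → ℝ) (p : M) : ℝ :=
  coordLaplacian (metricIn g e) (u ∘ e.symm) (e p)

/-- The weighted Laplacian `Δ_f u = Δu - ∇_{grad f} u` at `p`, computed in the chart `e`
around `p`. -/
def weightedLaplacian (g : Metric n M) (f : M → ℝ) (e : OpenPartialHomeomorph M (Model n))
    (u : M → ℝ) (p : M) : ℝ :=
  laplacian g e u p - differential u p (grad g f p)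

/-- `|Hess f|²` at `p`, computed in the chart `e` around `p`. -/
def hessNormSq (g : Metric n M) (e : OpenPartialHomeomorph M (Model n)) (f : M → ℝ) (p : M) : ℝ :=
  coordTensorNormSq (metricIn g e (e p))
    (fun i j => coordHess (metricIn g e) (f ∘ e.symm) i j (e p))

end Manifolds

end EtaRicci

end

/-! Write `H = Hess f`, `S` for Ricci, `u = |grad f|²`. Since `L_ξ g = 2 H`, the soliton equation
reads `H + S + λ g + μ df ⊗ df = 0`. As `Δf = 0`, its trace is `scal = -nλ - μ u`, so `d scal = -μ
du = -2μ H(grad f)`, while its divergence is `div S = -div H - μ H(grad f)`. The contracted Bianchi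
identity `d scal = 2 div S` (`deriv_scal`) therefore forces `div H = 0`.

Two consequences follow. The commutation formula `div H = d Δf + S(grad f)` (`divT_hessMatrix`)
gives `S(grad f) = 0`, and Bochner's formula (`contr_hess_gradNormSq`) reduces to `½ Δu = |H|²`.
Applying the soliton equation to `grad f` then gives `H(grad f) = -(λ + μ u) df`, hence `½ g(grad f,
grad u) = H(grad f, grad f) = -λ u - μ u²`. Subtracting is the claim (`soliton_identity`).

All of this uses only commuting derivations and the product rule, so it is proved over an arbitrary
commutative `ℝ`-algebra. Smooth functions on a chart target form such an algebra; evaluation at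
points turns the algebraic identity into the coordinate one (`coord_soliton_identity`), and the
chart frame carries it to the manifold. -/

noncomputable section

namespace EtaRicci

/-! ### Tensor calculus over a commutative ring with commuting derivations. -/

section DifferentialAlgebra

open Matrix

variable {n : ℕ} {A : Type*} [CommRing A]

section Contraction

/-- Full contraction of two matrices. -/
def contr (h T : Matrix (Fin n) (Fin n) A) : A := ∑ i, ∑ j, h i j * T i j

/-- Makes linearity and cyclicity of the trace available for contractions. -/
theorem contr_eq_trace (h T : Matrix (Fin n) (Fin n) A) : contr h T = trace (h * Tᵀ) := by
  simp [contr, trace, Matrix.mul_apply]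

theorem contr_add (h S T : Matrix (Fin n) (Fin n) A) :
    contr h (S + T) = contr h S + contr h T := by
  simp [contr_eq_trace, Matrix.mul_add]

theorem contr_sub (h S T : Matrix (Fin n) (Fin n) A) :
    contr h (S - T) = contr h S - contr h T := by
  simp [contr_eq_trace, Matrix.mul_sub]

theorem contr_neg (h T : Matrix (Fin n) (Fin n) A) : contr h (-T) = -contr h T := by
  simp [contr_eq_trace]

theorem contr_smul (h T : Matrix (Fin n) (Fin n) A) (a : A) :
    contr h (a • T) = a * contr h T := by
  simp [contr_eq_trace]

theorem contr_sum {ι : Type*} (s : Finset ι) (h : Matrix (Fin n) (Fin n) A)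
    (T : ι → Matrix (Fin n) (Fin n) A) : contr h (∑ i ∈ s, T i) = ∑ i ∈ s, contr h (T i) := by
  simp [contr_eq_trace, Matrix.mul_sum, Matrix.transpose_sum, Matrix.trace_sum]

theorem contr_of_transpose (h T : Matrix (Fin n) (Fin n) A) (hsym : ∀ i j, h i j = h j i) :
    contr h Tᵀ = contr h T := by
  simp only [contr, Matrix.transpose_apply]
  rw [Finset.sum_comm]
  simp only [hsym]

end Contraction

/-! ### Derivations of matrices and covariant derivatives. -/

variable [Algebra ℝ A]

/-- A derivation applied to the entries of a matrix. -/
def matD (d : Derivation ℝ A A) (T : Matrix (Fin n) (Fin n) A) : Matrix (Fin n) (Fin n) A :=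
  T.map d

@[simp] theorem matD_apply (d : Derivation ℝ A A) (T : Matrix (Fin n) (Fin n) A) (i j : Fin n) :
    matD d T i j = d (T i j) := rfl

theorem matD_mul (d : Derivation ℝ A A) (S T : Matrix (Fin n) (Fin n) A) :
    matD d (S * T) = matD d S * T + S * matD d T := by
  ext i j
  simp only [matD_apply, Matrix.mul_apply, Matrix.add_apply, map_sum, Derivation.leibniz,
    smul_eq_mul, Finset.sum_add_distrib]
  rw [add_comm]
  congr 1
  exact Finset.sum_congr rfl fun _ _ => mul_comm _ _

theorem matD_add (d : Derivation ℝ A A) (S T : Matrix (Fin n) (Fin n) A) :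
    matD d (S + T) = matD d S + matD d T := by ext; simp

theorem matD_sub (d : Derivation ℝ A A) (S T : Matrix (Fin n) (Fin n) A) :
    matD d (S - T) = matD d S - matD d T := by ext; simp

theorem matD_neg (d : Derivation ℝ A A) (S : Matrix (Fin n) (Fin n) A) :
    matD d (-S) = -matD d S := by ext; simp

theorem matD_transpose (d : Derivation ℝ A A) (S : Matrix (Fin n) (Fin n) A) :
    matD d Sᵀ = (matD d S)ᵀ := rfl

theorem matD_one (d : Derivation ℝ A A) : matD d (1 : Matrix (Fin n) (Fin n) A) = 0 := by
  ext i j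
  by_cases h : i = j <;> simp [h]

theorem deriv_contr (d : Derivation ℝ A A) (h T : Matrix (Fin n) (Fin n) A) :
    d (contr h T) = contr (matD d h) T + contr h (matD d T) := by
  simp only [contr, map_sum, Derivation.leibniz, smul_eq_mul, matD_apply,
    ← Finset.sum_add_distrib]
  exact Finset.sum_congr rfl fun _ _ => Finset.sum_congr rfl fun _ _ => by ring

/-- The covariant derivative of a `(0,2)`-tensor, for one connection matrix `C`. -/
def covD (d : Derivation ℝ A A) (C T : Matrix (Fin n) (Fin n) A) : Matrix (Fin n) (Fin n) A :=
  matD d T - Cᵀ * T - T * C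

theorem covD_apply (d : Derivation ℝ A A) (C T : Matrix (Fin n) (Fin n) A) (i j : Fin n) :
    covD d C T i j = d (T i j) - ∑ p, C p i * T p j - ∑ p, C p j * T i p := by
  simp only [covD, Matrix.sub_apply, Matrix.mul_apply, matD_apply, Matrix.transpose_apply]
  congr 1
  exact Finset.sum_congr rfl fun _ _ => mul_comm _ _

theorem covD_transpose (d : Derivation ℝ A A) (C T : Matrix (Fin n) (Fin n) A) :
    (covD d C T)ᵀ = covD d C Tᵀ := by
  simp only [covD, Matrix.transpose_sub, Matrix.transpose_mul, Matrix.transpose_transpose,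
    matD_transpose]
  abel

/-- The inverse metric is parallel, so that contraction commutes with covariant derivatives. -/
theorem contr_covD (d : Derivation ℝ A A) (C h T : Matrix (Fin n) (Fin n) A)
    (hh : matD d h = -(C * h) - h * Cᵀ) :
    contr h (covD d C T) = d (contr h T) := by
  rw [deriv_contr, hh]
  simp only [contr_eq_trace, covD, Matrix.transpose_sub, Matrix.transpose_mul,
    Matrix.transpose_transpose, Matrix.mul_sub, Matrix.sub_mul, Matrix.neg_mul, trace_sub,
    trace_neg, ← matD_transpose]
  rw [← Matrix.mul_assoc h Tᵀ C, Matrix.trace_mul_comm (h * Tᵀ) C, Matrix.mul_assoc C h,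
    Matrix.mul_assoc h Cᵀ]
  ring

/-- Raising an index commutes with covariant differentiation because `h` is parallel: the right side
is the covariant derivative of the mixed tensor `T * h`. -/
theorem covD_mul_inv (d : Derivation ℝ A A) (C h T : Matrix (Fin n) (Fin n) A)
    (hh : matD d h = -(C * h) - h * Cᵀ) :
    covD d C T * h = matD d (T * h) + T * h * Cᵀ - Cᵀ * (T * h) := by
  rw [matD_mul, hh, covD]
  noncomm_ring

/-- Differentiate `g * h = 1` and multiply by `h` on the left: a parallel metric has a parallel
inverse. -/
theorem matD_inv (d : Derivation ℝ A A) (C g h : Matrix (Fin n) (Fin n) A)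
    (hg : matD d g = Cᵀ * g + g * C) (hgh : g * h = 1) :
    matD d h = -(C * h) - h * Cᵀ := by
  have hhg : h * g = 1 := mul_eq_one_comm.mp hgh
  have h1 := matD_mul d g h
  rw [hgh, matD_one, hg] at h1
  have h2 : h * ((Cᵀ * g + g * C) * h + g * matD d h) = 0 := by rw [← h1, Matrix.mul_zero]
  have h3 : h * ((Cᵀ * g + g * C) * h + g * matD d h)
      = h * Cᵀ * (g * h) + (h * g) * C * h + (h * g) * matD d h := by noncomm_ring
  rw [h3, hgh, hhg, Matrix.mul_one, Matrix.one_mul, Matrix.one_mul] at h2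
  rw [← sub_eq_zero, ← h2]
  abel

/-! ### Curvature and the Bianchi identities. -/

/-- The curvature matrices `(R_ij)^k_l` of the connection matrices `(Γ_i)^k_j`. -/
def curv (D : Fin n → Derivation ℝ A A) (Γ : Fin n → Matrix (Fin n) (Fin n) A) (i j : Fin n) :
    Matrix (Fin n) (Fin n) A :=
  matD (D i) (Γ j) - matD (D j) (Γ i) + Γ i * Γ j - Γ j * Γ i

/-- The Ricci tensor `S_ij = (R_ki)^k_j`. -/
def ric (D : Fin n → Derivation ℝ A A) (Γ : Fin n → Matrix (Fin n) (Fin n) A) :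
    Matrix (Fin n) (Fin n) A :=
  Matrix.of fun i j => ∑ k, curv D Γ k i k j

theorem curv_antisymm (D : Fin n → Derivation ℝ A A) (Γ : Fin n → Matrix (Fin n) (Fin n) A)
    (i j : Fin n) : curv D Γ i j = -curv D Γ j i := by
  simp only [curv]; abel

/-- The commutator of two covariant derivatives acts on `h` through the curvature, and annihilates
it since `h` is parallel. In the code, the equation for `∂h` is differentiated again and `∂_i ∂_j h
= ∂_j ∂_i h` is used. -/
theorem curv_mul_inv_antisymm (D : Fin n → Derivation ℝ A A)
    (hD : ∀ i j a, D i (D j a) = D j (D i a)) (Γ : Fin n → Matrix (Fin n) (Fin n) A)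
    (h : Matrix (Fin n) (Fin n) A) (hh : ∀ m, matD (D m) h = -(Γ m * h) - h * (Γ m)ᵀ)
    (i j : Fin n) : curv D Γ i j * h = -(h * (curv D Γ i j)ᵀ) := by
  have h1 : matD (D i) (matD (D j) h) = matD (D j) (matD (D i) h) := by
    ext a b; exact hD _ _ _
  rw [hh i, hh j] at h1
  simp only [matD_sub, matD_neg, matD_mul, hh, matD_transpose] at h1
  rw [← sub_eq_zero] at h1
  rw [← sub_eq_zero, ← neg_eq_zero, ← h1]
  simp only [curv, Matrix.transpose_sub, Matrix.transpose_add, Matrix.transpose_mul]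
  noncomm_ring

/-- The identity `dΩ + [ω, Ω] = 0`, valid for every connection, with or without torsion: second
derivatives cancel in pairs and the rest is noncommutative algebra. -/
theorem bianchi_matrix (D : Fin n → Derivation ℝ A A)
    (hD : ∀ i j a, D i (D j a) = D j (D i a)) (Γ : Fin n → Matrix (Fin n) (Fin n) A)
    (m i j : Fin n) :
    (matD (D m) (curv D Γ i j) + Γ m * curv D Γ i j - curv D Γ i j * Γ m) +
    (matD (D i) (curv D Γ j m) + Γ i * curv D Γ j m - curv D Γ j m * Γ i) +
    (matD (D j) (curv D Γ m i) + Γ j * curv D Γ m i - curv D Γ m i * Γ j) = 0 := by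
  have hc : ∀ a b (T : Matrix (Fin n) (Fin n) A),
      matD (D a) (matD (D b) T) = matD (D b) (matD (D a) T) := fun a b T => by
    ext; exact hD _ _ _
  simp only [curv, matD_sub, matD_add, matD_mul]
  rw [hc i m, hc j m, hc j i]
  noncomm_ring

/-- The covariant derivative `∇_m R_ij` of the curvature, as an endomorphism. -/
def covCurv (D : Fin n → Derivation ℝ A A) (Γ : Fin n → Matrix (Fin n) (Fin n) A)
    (m i j : Fin n) : Matrix (Fin n) (Fin n) A :=
  matD (D m) (curv D Γ i j) + Γ m * curv D Γ i j - curv D Γ i j * Γ m -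
    ∑ p, Γ m p i • curv D Γ p j - ∑ p, Γ m p j • curv D Γ i p

/-- The second Bianchi identity. -/
theorem bianchi (D : Fin n → Derivation ℝ A A)
    (hD : ∀ i j a, D i (D j a) = D j (D i a)) (Γ : Fin n → Matrix (Fin n) (Fin n) A)
    (hΓ : ∀ k i j, Γ i k j = Γ j k i) (m i j : Fin n) :
    covCurv D Γ m i j + covCurv D Γ i j m + covCurv D Γ j m i = 0 := by
  -- The corrections for the two form indices cancel in pairs: `Γ` is symmetric in its lower indices
  -- and the curvature antisymmetric in `i, j`.
  have key : ∑ p, Γ m p i • curv D Γ p j + ∑ p, Γ m p j • curv D Γ i p +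
      (∑ p, Γ i p j • curv D Γ p m + ∑ p, Γ i p m • curv D Γ j p) +
      (∑ p, Γ j p m • curv D Γ p i + ∑ p, Γ j p i • curv D Γ m p) = 0 := by
    simp only [← Finset.sum_add_distrib]
    refine Finset.sum_eq_zero fun p _ => ?_
    rw [hΓ p i m, hΓ p j m, hΓ p j i, curv_antisymm D Γ j p, curv_antisymm D Γ i p,
      curv_antisymm D Γ m p]
    simp only [smul_neg]
    abel
  have hb := bianchi_matrix D hD Γ m i j
  simp only [covCurv]
  rw [← sub_eq_zero] at hb
  rw [← sub_eq_zero, sub_zero]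
  have : ∀ a b c x y z u v w : Matrix (Fin n) (Fin n) A, a + b + c - 0 = 0 →
      x + u + (y + v) + (z + w) = 0 → (a - x - u) + (b - y - v) + (c - z - w) = 0 := by
    intro a b c x y z u v w h1 h2
    have : (a - x - u) + (b - y - v) + (c - z - w)
      = (a + b + c - 0) - (x + u + (y + v) + (z + w)) := by abel
    rw [this, h1, h2, sub_zero]
  exact this _ _ _ _ _ _ _ _ _ hb key

/-- The trace of `∇_m R` is `∇_m S`. -/
theorem sum_covCurv (D : Fin n → Derivation ℝ A A) (Γ : Fin n → Matrix (Fin n) (Fin n) A)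
    (m j l : Fin n) :
    ∑ i, covCurv D Γ m i j i l = covD (D m) (Γ m) (ric D Γ) j l := by
  rw [covD_apply]
  simp only [covCurv, Matrix.sub_apply, Matrix.add_apply, Matrix.mul_apply, matD_apply,
    Matrix.sum_apply, Matrix.smul_apply, smul_eq_mul, Finset.sum_sub_distrib,
    Finset.sum_add_distrib, ric, Matrix.of_apply, map_sum, Finset.mul_sum]
  rw [Finset.sum_comm (f := fun i p => Γ m p i * curv D Γ p j i l)]
  rw [Finset.sum_comm (f := fun i p => Γ m p j * curv D Γ i p i l)]
  rw [Finset.sum_comm (f := fun i p => curv D Γ i j i p * Γ m p l)]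
  simp only [mul_comm (curv D Γ _ _ _ _) (Γ _ _ _)]
  ring

/-- Raise the last index of the curvature with `h`; antisymmetry then swaps it with `k`, at the cost
of a sign, and the sum over `j` becomes the trace defining Ricci. -/
theorem contr_curv (D : Fin n → Derivation ℝ A A)
    (hD : ∀ i j a, D i (D j a) = D j (D i a)) (Γ : Fin n → Matrix (Fin n) (Fin n) A)
    (h : Matrix (Fin n) (Fin n) A) (hsym : ∀ i j, h i j = h j i)
    (hh : ∀ m, matD (D m) h = -(Γ m * h) - h * (Γ m)ᵀ) (m k : Fin n) :
    contr h (Matrix.of fun j l => curv D Γ j m k l) = -(ric D Γ * h) m k := by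
  have h1 : contr h (Matrix.of fun j l => curv D Γ j m k l) = ∑ j, (curv D Γ j m * h) k j := by
    simp only [contr, Matrix.of_apply, Matrix.mul_apply]
    refine Finset.sum_congr rfl fun j _ => Finset.sum_congr rfl fun l _ => ?_
    rw [hsym j l, mul_comm]
  rw [h1]
  simp only [curv_mul_inv_antisymm D hD Γ h hh, Matrix.neg_apply, Finset.sum_neg_distrib]
  simp only [Matrix.mul_apply, ric, Matrix.of_apply, Matrix.transpose_apply, Finset.sum_mul]
  rw [Finset.sum_comm]
  congr 1
  refine Finset.sum_congr rfl fun j _ => Finset.sum_congr rfl fun l _ => ?_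
  rw [hsym k j, mul_comm]

/-- The divergence of a `(0,2)`-tensor, `(div T)_m = h^jl ∇_j T_ml`. -/
def divT (D : Fin n → Derivation ℝ A A) (Γ : Fin n → Matrix (Fin n) (Fin n) A)
    (h T : Matrix (Fin n) (Fin n) A) (m : Fin n) : A :=
  contr h (Matrix.of fun j l => covD (D j) (Γ j) T m l)

/-- The covariant derivative of `contr_curv`. The connection terms on the contracted indices `j, l`
are absorbed in `covD`; those on `k` and `m` appear as the two separate sums. -/
theorem contr_covCurv (D : Fin n → Derivation ℝ A A)
    (hD : ∀ i j a, D i (D j a) = D j (D i a)) (Γ : Fin n → Matrix (Fin n) (Fin n) A)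
    (h : Matrix (Fin n) (Fin n) A) (hsym : ∀ i j, h i j = h j i)
    (hh : ∀ m, matD (D m) h = -(Γ m * h) - h * (Γ m)ᵀ) (m i k : Fin n) :
    contr h (Matrix.of fun j l => covCurv D Γ i j m k l) =
      -(covD (D i) (Γ i) (ric D Γ) * h) m k := by
  have h1 : (Matrix.of fun j l => covCurv D Γ i j m k l) =
      covD (D i) (Γ i) (Matrix.of fun j l => curv D Γ j m k l)
      + ∑ p, Γ i k p • (Matrix.of fun j l => curv D Γ j m p l)
      - ∑ p, Γ i p m • (Matrix.of fun j l => curv D Γ j p k l) := by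
    ext j l
    simp only [covCurv, Matrix.of_apply, Matrix.sub_apply, Matrix.add_apply, covD_apply,
      Matrix.mul_apply, matD_apply, Matrix.sum_apply, Matrix.smul_apply, smul_eq_mul,
      mul_comm (curv D Γ _ _ _ _) (Γ _ _ _)]
    ring
  rw [h1, contr_sub, contr_add, contr_covD _ _ _ _ (hh i), contr_sum, contr_sum,
    covD_mul_inv _ _ _ _ (hh i)]
  simp only [contr_smul, contr_curv D hD Γ h hsym hh, Matrix.sub_apply, Matrix.add_apply,
    matD_apply]
  rw [Matrix.mul_apply (M := ric D Γ * h), Matrix.mul_apply (M := (Γ i)ᵀ)]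
  simp only [Matrix.transpose_apply, mul_neg, Finset.sum_neg_distrib, map_neg,
    mul_comm (Γ i k _), neg_mul]
  ring

/-- The contracted second Bianchi identity `d scal = 2 div S`. -/
theorem deriv_scal (D : Fin n → Derivation ℝ A A)
    (hD : ∀ i j a, D i (D j a) = D j (D i a)) (Γ : Fin n → Matrix (Fin n) (Fin n) A)
    (hΓ : ∀ k i j, Γ i k j = Γ j k i)
    (h : Matrix (Fin n) (Fin n) A) (hsym : ∀ i j, h i j = h j i)
    (hh : ∀ m, matD (D m) h = -(Γ m * h) - h * (Γ m)ᵀ) (m : Fin n) :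
    D m (contr h (ric D Γ)) = 2 * divT D Γ h (ric D Γ) m := by
  -- The second Bianchi identity traced once. Tracing again with `h` gives `D m scal` minus two
  -- copies of the divergence.
  have hB : covD (D m) (Γ m) (ric D Γ) - (Matrix.of fun j l => covD (D j) (Γ j) (ric D Γ) m l)
      + ∑ i, (Matrix.of fun j l => covCurv D Γ i j m i l) = 0 := by
    ext j l
    have h0 : ∀ i, covCurv D Γ m i j i l + covCurv D Γ i j m i l + covCurv D Γ j m i i l = 0 :=
      fun i => by
        have := congrFun (congrFun (bianchi D hD Γ hΓ m i j) i) l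
        simpa using this
    have hanti : ∀ i, covCurv D Γ j m i = -covCurv D Γ j i m := fun i => by
      simp only [covCurv]
      rw [curv_antisymm D Γ m i]
      simp only [matD_neg, curv_antisymm D Γ m _, curv_antisymm D Γ _ i, smul_neg,
        Finset.sum_neg_distrib, Matrix.mul_neg, Matrix.neg_mul]
      abel
    have h2 := Finset.sum_congr (s₁ := Finset.univ) rfl fun i _ => h0 i
    simp only [hanti, Matrix.neg_apply, Finset.sum_add_distrib, Finset.sum_neg_distrib,
      sum_covCurv, Finset.sum_const_zero] at h2
    simp only [Matrix.sub_apply, Matrix.add_apply, Matrix.of_apply, Matrix.sum_apply,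
      Matrix.zero_apply]
    rw [← h2]
    ring
  have h3 := congrArg (contr h) hB
  rw [contr_add, contr_sub, contr_covD _ _ _ _ (hh m), contr_sum] at h3
  simp only [contr_covCurv D hD Γ h hsym hh] at h3
  have h4 : ∑ i, (covD (D i) (Γ i) (ric D Γ) * h) m i = divT D Γ h (ric D Γ) m := by
    simp only [divT, contr, Matrix.mul_apply, Matrix.of_apply]
    refine Finset.sum_congr rfl fun i _ => Finset.sum_congr rfl fun l _ => ?_
    rw [hsym i l, mul_comm]
  rw [Finset.sum_neg_distrib, h4] at h3
  have h5 : contr h (0 : Matrix (Fin n) (Fin n) A) = 0 := by simp [contr]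
  rw [h5] at h3
  change _ - divT D Γ h (ric D Γ) m + _ = 0 at h3
  linear_combination h3

/-! ### The Levi-Civita connection. -/

/-- The Christoffel matrices `(Γ_i)^k_j` of the metric `g` with inverse `h`. -/
def christoffelMatrix (D : Fin n → Derivation ℝ A A) (g h : Matrix (Fin n) (Fin n) A)
    (i : Fin n) : Matrix (Fin n) (Fin n) A :=
  Matrix.of fun k j => (1 / 2 : ℝ) • ∑ l, h k l * (D i (g j l) + D j (g i l) - D l (g i j))

theorem christoffelMatrix_symm (D : Fin n → Derivation ℝ A A) (g h : Matrix (Fin n) (Fin n) A)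
    (hg : ∀ i j, g i j = g j i) (k i j : Fin n) :
    christoffelMatrix D g h i k j = christoffelMatrix D g h j k i := by
  simp only [christoffelMatrix, Matrix.of_apply]
  congr 1
  refine Finset.sum_congr rfl fun l _ => ?_
  rw [hg i j, add_comm (D i _)]

/-- Lowering the upper index cancels `h` and leaves the Christoffel symbols of the first kind. -/
theorem mul_christoffelMatrix (D : Fin n → Derivation ℝ A A) (g h : Matrix (Fin n) (Fin n) A)
    (hgh : g * h = 1) (m i j : Fin n) :
    (g * christoffelMatrix D g h m) i j =
      (1 / 2 : ℝ) • (D m (g j i) + D j (g m i) - D i (g m j)) := by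
  have h1 : (g * christoffelMatrix D g h m) i j =
      (1 / 2 : ℝ) • ∑ l, (g * h) i l * (D m (g j l) + D j (g m l) - D l (g m j)) := by
    simp only [Matrix.mul_apply, christoffelMatrix, Matrix.of_apply, mul_smul_comm,
      ← Finset.smul_sum, Finset.mul_sum, Finset.sum_mul]
    rw [Finset.sum_comm]
    simp only [mul_assoc]
  rw [h1, hgh]
  simp [Matrix.one_apply]

/-- The Levi-Civita connection is metric. -/
theorem matD_metric (D : Fin n → Derivation ℝ A A) (g h : Matrix (Fin n) (Fin n) A)
    (hg : ∀ i j, g i j = g j i) (hgh : g * h = 1) (m : Fin n) :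
    matD (D m) g = (christoffelMatrix D g h m)ᵀ * g + g * christoffelMatrix D g h m := by
  have hgT : gᵀ = g := by ext i j; exact hg j i
  have h1 : (christoffelMatrix D g h m)ᵀ * g = (g * christoffelMatrix D g h m)ᵀ := by
    rw [Matrix.transpose_mul, hgT]
  ext i j
  rw [h1, Matrix.add_apply, Matrix.transpose_apply, mul_christoffelMatrix D g h hgh,
    mul_christoffelMatrix D g h hgh, matD_apply, ← smul_add, hg j i]
  have h2 : D m (g i j) + D i (g m j) - D j (g m i) + (D m (g i j) + D j (g m i) - D i (g m j))
      = (2 : ℝ) • D m (g i j) := by rw [two_smul]; ring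
  rw [h2, smul_smul]
  norm_num

/-! ### The Hessian, the Ricci identity and Bochner's formula. -/

/-- The Hessian `∇_i ∂_j f` of `f`. -/
def hessMatrix (D : Fin n → Derivation ℝ A A) (Γ : Fin n → Matrix (Fin n) (Fin n) A) (f : A) :
    Matrix (Fin n) (Fin n) A :=
  Matrix.of fun i j => D i (D j f) - ∑ k, Γ i k j * D k f

theorem hessMatrix_symm (D : Fin n → Derivation ℝ A A)
    (hD : ∀ i j a, D i (D j a) = D j (D i a)) (Γ : Fin n → Matrix (Fin n) (Fin n) A)
    (hΓ : ∀ k i j, Γ i k j = Γ j k i) (f : A) (i j : Fin n) :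
    hessMatrix D Γ f i j = hessMatrix D Γ f j i := by
  simp only [hessMatrix, Matrix.of_apply, hD i j, hΓ _ i j]

/-- The Ricci identity for `df`. -/
theorem ricci_identity (D : Fin n → Derivation ℝ A A)
    (hD : ∀ i j a, D i (D j a) = D j (D i a)) (Γ : Fin n → Matrix (Fin n) (Fin n) A)
    (hΓ : ∀ k i j, Γ i k j = Γ j k i) (f : A) (k i j : Fin n) :
    covD (D k) (Γ k) (hessMatrix D Γ f) i j - covD (D i) (Γ i) (hessMatrix D Γ f) k j =
      -∑ l, curv D Γ k i l j * D l f := by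
  have e1 : ∑ p, Γ k p i * hessMatrix D Γ f p j = ∑ p, Γ i p k * hessMatrix D Γ f p j :=
    Finset.sum_congr rfl fun p _ => by rw [hΓ p k i]
  have e2 : ∀ a b, ∑ p, Γ a p j * hessMatrix D Γ f b p =
      ∑ p, Γ a p j * D b (D p f) - ∑ l, (Γ b * Γ a) l j * D l f := fun a b => by
    simp only [hessMatrix, Matrix.of_apply, mul_sub, Finset.sum_sub_distrib, Matrix.mul_apply,
      Finset.sum_mul, Finset.mul_sum]
    congr 1
    rw [Finset.sum_comm]
    exact Finset.sum_congr rfl fun _ _ => Finset.sum_congr rfl fun _ _ => by ring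
  have e3 : ∀ a b, D a (hessMatrix D Γ f b j) = D a (D b (D j f)) -
      ∑ p, Γ b p j * D a (D p f) - ∑ l, D a (Γ b l j) * D l f := fun a b => by
    simp only [hessMatrix, Matrix.of_apply, map_sub, map_sum, Derivation.leibniz, smul_eq_mul,
      Finset.sum_add_distrib, mul_comm (D _ f)]
    ring
  rw [covD_apply, covD_apply, e1, e2 k i, e2 i k, e3 k i, e3 i k, hD k i]
  simp only [curv, Matrix.sub_apply, Matrix.add_apply, matD_apply, sub_mul, add_mul,
    Finset.sum_sub_distrib, Finset.sum_add_distrib]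
  ring

/-- The commutation formula `div Hess f = d Δf + S(grad f)`. -/
theorem divT_hessMatrix (D : Fin n → Derivation ℝ A A)
    (hD : ∀ i j a, D i (D j a) = D j (D i a)) (Γ : Fin n → Matrix (Fin n) (Fin n) A)
    (hΓ : ∀ k i j, Γ i k j = Γ j k i)
    (h : Matrix (Fin n) (Fin n) A) (hsym : ∀ i j, h i j = h j i)
    (hh : ∀ m, matD (D m) h = -(Γ m * h) - h * (Γ m)ᵀ) (f : A) (m : Fin n) :
    divT D Γ h (hessMatrix D Γ f) m =
      D m (contr h (hessMatrix D Γ f)) + ∑ l, (ric D Γ * h) m l * D l f := by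
  -- The Ricci identity replaces `∇_j H_ml` by `∇_m H_jl` plus curvature; the contraction of the
  -- former term is `d Δf`.
  have h1 : (Matrix.of fun j l => covD (D j) (Γ j) (hessMatrix D Γ f) m l) =
      covD (D m) (Γ m) (hessMatrix D Γ f) -
        ∑ p, D p f • (Matrix.of fun j l => curv D Γ j m p l) := by
    ext j l
    simp only [Matrix.of_apply, Matrix.sub_apply, Matrix.sum_apply, Matrix.smul_apply,
      smul_eq_mul]
    rw [← sub_eq_iff_eq_add'.mpr (sub_eq_iff_eq_add.mp (ricci_identity D hD Γ hΓ f j m l))]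
    simp only [mul_comm (D _ f)]
    ring
  rw [divT, h1, contr_sub, contr_covD _ _ _ _ (hh m), contr_sum]
  simp only [contr_smul, contr_curv D hD Γ h hsym hh, mul_neg, Finset.sum_neg_distrib,
    mul_comm _ (D _ f)]
  ring

/-- The squared norm `h^ij f_i f_j` of the gradient. -/
def gradNormSq (D : Fin n → Derivation ℝ A A) (h : Matrix (Fin n) (Fin n) A) (f : A) : A :=
  contr h (Matrix.of fun i j => D i f * D j f)

theorem covD_mul_symm_deriv (D : Fin n → Derivation ℝ A A)
    (Γ : Fin n → Matrix (Fin n) (Fin n) A) (f : A) (m i j : Fin n) :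
    covD (D m) (Γ m) (Matrix.of fun i j => D i f * D j f) i j =
      hessMatrix D Γ f m i * D j f + D i f * hessMatrix D Γ f m j := by
  simp only [covD_apply, Matrix.of_apply, hessMatrix, Derivation.leibniz, smul_eq_mul, sub_mul,
    mul_sub, Finset.sum_mul, Finset.mul_sum]
  have e : ∑ k, D i f * (Γ m k j * D k f) = ∑ k, Γ m k j * (D i f * D k f) :=
    Finset.sum_congr rfl fun _ _ => by ring
  simp only [e, mul_assoc]
  ring

/-- Metric compatibility moves the derivative onto `df ⊗ df`, whose two Leibniz terms are transposes
of each other and contract equally. -/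
theorem deriv_gradNormSq (D : Fin n → Derivation ℝ A A)
    (Γ : Fin n → Matrix (Fin n) (Fin n) A)
    (h : Matrix (Fin n) (Fin n) A) (hsym : ∀ i j, h i j = h j i)
    (hh : ∀ m, matD (D m) h = -(Γ m * h) - h * (Γ m)ᵀ) (f : A) (m : Fin n) :
    D m (gradNormSq D h f) = 2 * ∑ j, (hessMatrix D Γ f * h) m j * D j f := by
  rw [gradNormSq, ← contr_covD _ _ _ _ (hh m)]
  have h1 : covD (D m) (Γ m) (Matrix.of fun i j => D i f * D j f) =
      (Matrix.of fun i j => hessMatrix D Γ f m i * D j f) +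
      (Matrix.of fun i j => hessMatrix D Γ f m i * D j f)ᵀ := by
    ext i j
    rw [covD_mul_symm_deriv, Matrix.add_apply, Matrix.transpose_apply, Matrix.of_apply,
      Matrix.of_apply, mul_comm (D i f)]
  have h2 : contr h (Matrix.of fun i j => hessMatrix D Γ f m i * D j f) =
      ∑ j, (hessMatrix D Γ f * h) m j * D j f := by
    simp only [contr, Matrix.of_apply, Matrix.mul_apply, Finset.sum_mul]
    rw [Finset.sum_comm]
    exact Finset.sum_congr rfl fun _ _ => Finset.sum_congr rfl fun _ _ => by ring
  rw [h1, contr_add, contr_of_transpose _ _ hsym, h2]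
  ring

/-- Bochner's formula, before commuting derivatives: `½ Δ|df|² = |Hess f|² + ⟨div Hess f, df⟩`. -/
theorem contr_hess_gradNormSq (D : Fin n → Derivation ℝ A A)
    (hD : ∀ i j a, D i (D j a) = D j (D i a)) (Γ : Fin n → Matrix (Fin n) (Fin n) A)
    (hΓ : ∀ k i j, Γ i k j = Γ j k i)
    (h : Matrix (Fin n) (Fin n) A) (hsym : ∀ i j, h i j = h j i)
    (hh : ∀ m, matD (D m) h = -(Γ m * h) - h * (Γ m)ᵀ) (f : A) :
    contr h (hessMatrix D Γ (gradNormSq D h f)) =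
      2 * (contr h (hessMatrix D Γ f * h * (hessMatrix D Γ f)ᵀ) +
        ∑ m, divT D Γ h (hessMatrix D Γ f) m * ∑ l, h m l * D l f) := by
  set H := hessMatrix D Γ f with hH
  -- Differentiating `du = 2 H(grad f)`: the derivative falls on `grad f`, giving `H h Hᵀ`, or on
  -- `H`.
  have h1 : hessMatrix D Γ (gradNormSq D h f) = (2 : A) • (H * h * Hᵀ) +
      (2 : A) • Matrix.of fun i j => ∑ q, (covD (D i) (Γ i) H * h) j q * D q f := by
    ext i j
    rw [hessMatrix, Matrix.of_apply]
    simp only [deriv_gradNormSq D Γ h hsym hh, ← hH, Matrix.add_apply, Matrix.smul_apply,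
      smul_eq_mul, Matrix.of_apply]
    rw [covD_mul_inv _ _ _ _ (hh i), Matrix.mul_apply (M := H * h)]
    simp only [Matrix.sub_apply, Matrix.add_apply, matD_apply, Matrix.transpose_apply]
    have e1 : ∑ j', (H * h) j j' * D i (D j' f) = ∑ j', (H * h) j j' * H i j' +
        ∑ q, (H * h * (Γ i)ᵀ) j q * D q f := by
      have : ∀ j', D i (D j' f) = H i j' + ∑ k, Γ i k j' * D k f := fun j' => by
        simp [hH, hessMatrix]
      simp only [this, mul_add, Finset.sum_add_distrib]
      congr 1
      simp only [Matrix.mul_apply (M := H * h), Matrix.transpose_apply, Finset.mul_sum,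
        Finset.sum_mul]
      rw [Finset.sum_comm]
      simp only [mul_assoc]
    have e2 : ∑ k, Γ i k j * (2 * ∑ j', (H * h) k j' * D j' f) =
        2 * ∑ q, ((Γ i)ᵀ * (H * h)) j q * D q f := by
      simp only [Matrix.mul_apply (M := (Γ i)ᵀ), Matrix.transpose_apply, Finset.mul_sum,
        Finset.sum_mul]
      rw [Finset.sum_comm]
      exact Finset.sum_congr rfl fun _ _ => Finset.sum_congr rfl fun _ _ => by ring
    have e3 : ∑ j', H i j' * (H * h) j j' = ∑ j', (H * h) j j' * H i j' :=
      Finset.sum_congr rfl fun _ _ => mul_comm _ _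
    have e4 : ∑ q, (H * h) i q * H j q = ∑ j', (H * h) j j' * H i j' := by
      have hHs : Hᵀ = H := by ext a b; exact hessMatrix_symm D hD Γ hΓ f b a
      have hhs : hᵀ = h := by ext a b; exact hsym b a
      have l : ∑ q, (H * h) i q * H j q = (H * h * Hᵀ) i j := by simp [Matrix.mul_apply (M := H*h)]
      have r : ∑ q, (H * h) j q * H i q = (H * h * Hᵀ)ᵀ i j := by
        simp [Matrix.mul_apply (M := H*h)]
      rw [l, r]
      simp only [Matrix.transpose_mul, Matrix.transpose_transpose, hhs, Matrix.mul_assoc]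
    have e5 : D i (2 * ∑ j', (H * h) j j' * D j' f) = 2 * (∑ j', (H * h) j j' * D i (D j' f) +
        ∑ j', D i ((H * h) j j') * D j' f) := by
      rw [two_mul, two_mul, map_add, map_sum]
      simp only [Derivation.leibniz, smul_eq_mul, Finset.sum_add_distrib, mul_comm (D _ f)]
    rw [e5, e1, e2, e4]
    simp only [sub_mul, add_mul, Finset.sum_add_distrib, Finset.sum_sub_distrib]
    ring
  rw [h1, contr_add, contr_smul, contr_smul, ← mul_add]
  congr 2
  -- Symmetry of `∇_i H` puts `j` last, so that the trace with `h i j` is the divergence of `H`.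
  have hcs : ∀ i a b, covD (D i) (Γ i) H a b = covD (D i) (Γ i) H b a := fun i a b => by
    have hHs : Hᵀ = H := by ext a b; exact hessMatrix_symm D hD Γ hΓ f b a
    conv_lhs => rw [← hHs, ← covD_transpose, Matrix.transpose_apply]
  have e : ∀ i j, ∑ q, (covD (D i) (Γ i) H * h) j q * D q f =
      ∑ p, covD (D i) (Γ i) H p j * ∑ q, h p q * D q f := fun i j => by
    simp only [Matrix.mul_apply, Finset.sum_mul, Finset.mul_sum]
    rw [Finset.sum_comm]
    simp only [hcs i j, mul_assoc]
  simp only [contr, divT, Matrix.of_apply, e]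
  set w : Fin n → A := fun p => ∑ q, h p q * D q f with hw
  change ∑ i, ∑ j, h i j * ∑ p, _ * w p = ∑ m, _ * w m
  simp only [Finset.mul_sum, Finset.sum_mul, ← mul_assoc]
  rw [Finset.sum_comm_cycle]

/-! ### Divergence and trace of the soliton equation. -/

theorem covD_add (d : Derivation ℝ A A) (C S T : Matrix (Fin n) (Fin n) A) :
    covD d C (S + T) = covD d C S + covD d C T := by
  simp only [covD, matD_add, Matrix.mul_add, Matrix.add_mul]
  abel

theorem covD_neg (d : Derivation ℝ A A) (C S : Matrix (Fin n) (Fin n) A) :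
    covD d C (-S) = -covD d C S := by
  simp only [covD, matD_neg, Matrix.mul_neg, Matrix.neg_mul]
  abel

theorem covD_smul (d : Derivation ℝ A A) (C S : Matrix (Fin n) (Fin n) A) (r : ℝ) :
    covD d C (r • S) = r • covD d C S := by
  have : matD d (r • S) = r • matD d S := by ext; simp
  simp only [covD, this, Matrix.mul_smul, Matrix.smul_mul, smul_sub]

theorem contr_real_smul (h T : Matrix (Fin n) (Fin n) A) (r : ℝ) :
    contr h (r • T) = r • contr h T := by
  simp [contr_eq_trace]

theorem divT_add (D : Fin n → Derivation ℝ A A) (Γ : Fin n → Matrix (Fin n) (Fin n) A)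
    (h S T : Matrix (Fin n) (Fin n) A) (m : Fin n) :
    divT D Γ h (S + T) m = divT D Γ h S m + divT D Γ h T m := by
  simp only [divT, covD_add, ← contr_add]
  rfl

theorem divT_neg (D : Fin n → Derivation ℝ A A) (Γ : Fin n → Matrix (Fin n) (Fin n) A)
    (h S : Matrix (Fin n) (Fin n) A) (m : Fin n) :
    divT D Γ h (-S) m = -divT D Γ h S m := by
  simp only [divT, covD_neg, ← contr_neg]
  rfl

theorem divT_smul (D : Fin n → Derivation ℝ A A) (Γ : Fin n → Matrix (Fin n) (Fin n) A)
    (h S : Matrix (Fin n) (Fin n) A) (r : ℝ) (m : Fin n) :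
    divT D Γ h (r • S) m = r • divT D Γ h S m := by
  simp only [divT, covD_smul, ← contr_real_smul]
  rfl

/-- Leibniz rule `div (df ⊗ df) = H(grad f) + Δf df`. -/
theorem divT_deriv_mul_deriv (D : Fin n → Derivation ℝ A A)
    (hD : ∀ i j a, D i (D j a) = D j (D i a)) (Γ : Fin n → Matrix (Fin n) (Fin n) A)
    (hΓ : ∀ k i j, Γ i k j = Γ j k i) (h : Matrix (Fin n) (Fin n) A) (f : A) (m : Fin n) :
    divT D Γ h (Matrix.of fun i j => D i f * D j f) m =
      ∑ j, (hessMatrix D Γ f * h) m j * D j f + D m f * contr h (hessMatrix D Γ f) := by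
  simp only [divT, contr, Matrix.of_apply, covD_mul_symm_deriv, mul_add, Finset.sum_add_distrib,
    Finset.mul_sum, Matrix.mul_apply, Finset.sum_mul]
  congr 1
  · rw [Finset.sum_comm]
    refine Finset.sum_congr rfl fun _ _ => Finset.sum_congr rfl fun _ _ => ?_
    rw [hessMatrix_symm D hD Γ hΓ f m]
    ring
  · exact Finset.sum_congr rfl fun _ _ => Finset.sum_congr rfl fun _ _ => by ring

theorem sum_mul_inv_deriv (D : Fin n → Derivation ℝ A A) (h T : Matrix (Fin n) (Fin n) A)
    (f : A) (m : Fin n) :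
    ∑ l, (T * h) m l * D l f = ∑ k, T m k * ∑ l, h k l * D l f := by
  simp only [Matrix.mul_apply, Finset.sum_mul, Finset.mul_sum]
  rw [Finset.sum_comm]
  simp only [mul_assoc]

/-- The Lie derivative of the metric along the gradient of `f` is `2 Hess f`. -/
theorem lie_metric_grad (D : Fin n → Derivation ℝ A A)
    (hD : ∀ i j a, D i (D j a) = D j (D i a)) (g h : Matrix (Fin n) (Fin n) A)
    (hg : ∀ i j, g i j = g j i) (hgh : g * h = 1) (hsym : ∀ i j, h i j = h j i) (f : A)
    (X : Fin n → A) (hX : ∀ k, X k = ∑ l, h k l * D l f) (i j : Fin n) :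
    ∑ k, (X k * D k (g i j) + g k j * D i (X k) + g i k * D j (X k)) =
      2 * hessMatrix D (christoffelMatrix D g h) f i j := by
  have h1 : ∀ a, ∑ k, g a k * X k = D a f := fun a => by
    have := sum_mul_inv_deriv D h g f a
    simp only [hX]
    rw [← this, hgh]
    simp [Matrix.one_apply]
  -- Differentiating `g(X) = df` trades the derivatives of `X` for second derivatives of `f` and
  -- first derivatives of `g`; the latter combine into the Christoffel term `h3`.
  have h2 : ∀ a b, ∑ k, g a k * D b (X k) = D b (D a f) - ∑ k, X k * D b (g a k) := fun a b => by
    rw [← h1 a]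
    simp only [map_sum, Derivation.leibniz, smul_eq_mul, Finset.sum_add_distrib]
    ring
  have h3 : ∑ k, christoffelMatrix D g h i k j * D k f =
      (1 / 2 : ℝ) • ∑ l, X l * (D i (g j l) + D j (g i l) - D l (g i j)) := by
    simp only [christoffelMatrix, Matrix.of_apply, smul_mul_assoc, ← Finset.smul_sum, hX,
      Finset.sum_mul]
    rw [Finset.sum_comm]
    congr 1
    refine Finset.sum_congr rfl fun l _ => Finset.sum_congr rfl fun k _ => ?_
    rw [hsym k l]
    ring
  have h4 : ∀ x : A, 2 * ((1 / 2 : ℝ) • x) = x := fun x => by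
    rw [two_mul, ← add_smul]; norm_num
  simp only [hessMatrix, Matrix.of_apply]
  rw [mul_sub, h3, h4]
  have h5 : ∑ k, g k j * D i (X k) = ∑ k, g j k * D i (X k) :=
    Finset.sum_congr rfl fun k _ => by rw [hg k j]
  simp only [Finset.sum_add_distrib, h5, h2, mul_add, mul_sub, Finset.sum_sub_distrib, hD j i]
  ring

/-- A gradient `η`-Ricci soliton with harmonic potential satisfies
`½ (Δu - ⟨grad f, grad u⟩) = |Hess f|² + λ u + μ u²` for `u = |grad f|²`. -/
theorem soliton_identity (D : Fin n → Derivation ℝ A A)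
    (hD : ∀ i j a, D i (D j a) = D j (D i a)) (g h : Matrix (Fin n) (Fin n) A)
    (hg : ∀ i j, g i j = g j i) (hgh : g * h = 1) (hsym : ∀ i j, h i j = h j i)
    (f : A) (lam mu : ℝ) (Γ : Fin n → Matrix (Fin n) (Fin n) A)
    (hΓdef : Γ = christoffelMatrix D g h)
    (hharm : contr h (hessMatrix D Γ f) = 0)
    (hsol : hessMatrix D Γ f + ric D Γ + lam • g +
      mu • (Matrix.of fun i j => D i f * D j f) = 0) :
    contr h (hessMatrix D Γ (gradNormSq D h f)) -
        ∑ m, D m (gradNormSq D h f) * ∑ l, h m l * D l f =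
      2 * (contr h (hessMatrix D Γ f * h * (hessMatrix D Γ f)ᵀ) + lam • gradNormSq D h f +
        mu • gradNormSq D h f ^ 2) := by
  have hΓ : ∀ k i j, Γ i k j = Γ j k i := by
    rw [hΓdef]; exact christoffelMatrix_symm D g h hg
  have hmet : ∀ m, matD (D m) g = (Γ m)ᵀ * g + g * Γ m := by
    rw [hΓdef]; exact matD_metric D g h hg hgh
  have hh : ∀ m, matD (D m) h = -(Γ m * h) - h * (Γ m)ᵀ := fun m =>
    matD_inv _ _ _ _ (hmet m) hgh
  set N : Matrix (Fin n) (Fin n) A := Matrix.of fun i j => D i f * D j f with hN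
  set H := hessMatrix D Γ f with hH
  set u := gradNormSq D h f with hu
  have hS : ric D Γ = -(H + lam • g + mu • N) := by
    rw [eq_neg_iff_add_eq_zero, ← hsol]; abel
  have hNu : contr h N = u := rfl
  have hgn : contr h g = (n : A) := by
    have hgT : gᵀ = g := by ext i j; exact hg j i
    rw [contr_eq_trace, hgT, mul_eq_one_comm.mp hgh]
    simp
  have hdg : ∀ m, divT D Γ h g m = 0 := fun m => by
    have : ∀ j, covD (D j) (Γ j) g = 0 := fun j => by rw [covD, hmet]; abel
    simp [divT, this, contr]
  have hdu : ∀ m, D m u = 2 * ∑ j, (H * h) m j * D j f := deriv_gradNormSq D Γ h hsym hh f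
  -- Substitute the soliton equation into `d scal = 2 div S`: both sides contain `-2μ H(grad f)`,
  -- and what remains is `2 div H = 0`.
  have hdivH : ∀ m, divT D Γ h H m = 0 := fun m => by
    have h1 := deriv_scal D hD Γ hΓ h hsym hh m
    rw [hS, divT_neg, divT_add, divT_add, divT_smul, divT_smul, hdg, contr_neg, contr_add,
      contr_add, contr_real_smul, contr_real_smul, hharm, hNu, hgn, hN,
      divT_deriv_mul_deriv D hD Γ hΓ, ← hH, hharm] at h1
    simp only [map_neg, map_add, map_zero, Derivation.map_smul, Derivation.map_natCast, hdu] at h1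
    simp only [Algebra.smul_def] at h1
    have h2 : (2 : A) * divT D Γ h H m = 0 := by linear_combination h1
    -- `A` may have zero divisors, so the factor 2 is removed by the real scalar ½.
    have h3 : (1 / 2 : ℝ) • ((2 : A) * divT D Γ h H m) = divT D Γ h H m := by
      rw [two_mul, ← two_smul ℝ, smul_smul]; norm_num
    rw [← h3, h2, smul_zero]
  have hSx : ∀ m, ∑ l, (ric D Γ * h) m l * D l f = 0 := fun m => by
    have h1 := divT_hessMatrix D hD Γ hΓ h hsym hh f m
    rw [← hH, hdivH, hharm, map_zero, zero_add] at h1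
    exact h1.symm
  have hBoch := contr_hess_gradNormSq D hD Γ hΓ h hsym hh f
  simp only [← hH, ← hu, hdivH, zero_mul, Finset.sum_const_zero, add_zero] at hBoch
  have hgx : ∀ m, ∑ l, g m l * ∑ k, h l k * D k f = D m f := fun m => by
    rw [← sum_mul_inv_deriv, hgh]
    simp [Matrix.one_apply]
  have hue : ∑ m, D m f * ∑ l, h m l * D l f = u := by
    simp only [hu, gradNormSq, contr, Matrix.of_apply, Finset.mul_sum]
    exact Finset.sum_congr rfl fun _ _ => Finset.sum_congr rfl fun _ _ => by ring
  -- The soliton equation applied to `grad f`, where the Ricci term vanishes by `hSx`.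
  have hHx : ∀ m, ∑ j, (H * h) m j * D j f = -(lam • D m f + mu • (D m f * u)) := fun m => by
    have h1 := hSx m
    rw [sum_mul_inv_deriv, hS] at h1
    rw [sum_mul_inv_deriv]
    simp only [Matrix.neg_apply, Matrix.add_apply, Matrix.smul_apply, neg_mul, add_mul,
      Finset.sum_neg_distrib, Finset.sum_add_distrib, smul_mul_assoc, ← Finset.smul_sum, hgx,
      hN, Matrix.of_apply] at h1
    simp only [mul_assoc, ← Finset.mul_sum, hue] at h1
    linear_combination -h1
  rw [hBoch]
  simp only [hdu, hHx, Algebra.smul_def]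
  have e : ∀ m, 2 * -(algebraMap ℝ A lam * D m f + algebraMap ℝ A mu * (D m f * u)) *
      ∑ l, h m l * D l f = -(2 * algebraMap ℝ A lam + 2 * algebraMap ℝ A mu * u) *
        (D m f * ∑ l, h m l * D l f) := fun m => by ring
  simp only [e, ← Finset.mul_sum, hue]
  ring

end DifferentialAlgebra

/-! ### The algebra of smooth functions on an open set of `ℝⁿ`. -/

section SmoothFunctions

variable {n : ℕ}

open Classical in
/-- Extension of a function by zero. -/
def extendZero {U : Set (Model n)} (u : U → ℝ) (y : Model n) : ℝ :=
  if h : y ∈ U then u ⟨y, h⟩ else 0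

@[simp] theorem extendZero_coe {U : Set (Model n)} (u : U → ℝ) (y : U) :
    extendZero u y = u y := by
  simp [extendZero]

/-- The algebra of smooth functions on `U`. -/
def smoothOn (U : Set (Model n)) : Subalgebra ℝ (U → ℝ) where
  carrier := {u | ContDiffOn ℝ ∞ (extendZero u) U}
  mul_mem' {a b} ha hb := (ContDiffOn.mul ha hb).congr fun y hy => by simp [extendZero, hy]
  add_mem' {a b} ha hb := (ContDiffOn.add ha hb).congr fun y hy => by simp [extendZero, hy]
  algebraMap_mem' r := (contDiffOn_const (c := r)).congr fun y hy => by simp [extendZero, hy]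

/-- The smooth function on `U` obtained by restriction. -/
def restrictSmooth {U : Set (Model n)} (u : Model n → ℝ) (hu : ContDiffOn ℝ ∞ u U) :
    smoothOn U :=
  ⟨fun y => u y, hu.congr fun y hy => by simp [extendZero, hy]⟩

/-- Evaluation of a function at a point. -/
def evalAt {U : Set (Model n)} (y : U) : smoothOn U →ₐ[ℝ] ℝ :=
  (Pi.evalAlgHom ℝ (fun _ : U => ℝ) y).comp (smoothOn U).val

theorem evalAt_restrictSmooth {U : Set (Model n)} (u : Model n → ℝ) (hu : ContDiffOn ℝ ∞ u U)
    (y : U) : evalAt y (restrictSmooth u hu) = u y := rfl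

theorem smoothOn_ext {U : Set (Model n)} {a b : smoothOn U}
    (h : ∀ y : U, evalAt y a = evalAt y b) : a = b :=
  Subtype.ext (funext h)

theorem smoothOn_differentiableAt {U : Set (Model n)} (hU : IsOpen U) (a : smoothOn U)
    (y : U) : DifferentiableAt ℝ (extendZero a.1) y :=
  (a.2.contDiffAt (hU.mem_nhds y.2)).differentiableAt (by simp)

theorem contDiffOn_pd {U : Set (Model n)} (hU : IsOpen U) {u : Model n → ℝ}
    (hu : ContDiffOn ℝ ∞ u U) (i : Fin n) : ContDiffOn ℝ ∞ (pd i u) U :=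
  (hu.fderiv_of_isOpen hU (m := ∞) (by simp)).clm_apply contDiffOn_const

/-- Partial derivatives see only germs, so on the open set `U` the arbitrary values of an extension
outside `U` do not matter. -/
theorem pd_congr {U : Set (Model n)} (hU : IsOpen U) {u v : Model n → ℝ}
    (h : ∀ y : U, u y = v y) (i : Fin n) (y : U) : pd i u y = pd i v y := by
  have : u =ᶠ[nhds (y : Model n)] v :=
    Set.EqOn.eventuallyEq_of_mem (fun z hz => h ⟨z, hz⟩) (hU.mem_nhds y.2)
  rw [pd, this.fderiv_eq, pd]

theorem pd_comm {U : Set (Model n)} (hU : IsOpen U) {u : Model n → ℝ}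
    (hu : ContDiffOn ℝ ∞ u U) (i j : Fin n) (y : U) :
    pd i (pd j u) y = pd j (pd i u) y := by
  have hc := hu.contDiffAt (hU.mem_nhds y.2)
  have hd : DifferentiableAt ℝ (fderiv ℝ u) y :=
    (((hu.fderiv_of_isOpen hU (m := ∞) (by simp))).contDiffAt
      (hU.mem_nhds y.2)).differentiableAt (by simp)
  have key : ∀ a b : Fin n, pd a (pd b u) y =
      fderiv ℝ (fderiv ℝ u) y (EuclideanSpace.single a 1) (EuclideanSpace.single b 1) :=
    fun a b => by
      have : pd b u = fun z => fderiv ℝ u z (EuclideanSpace.single b 1) := rfl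
      rw [pd, this, fderiv_clm_apply hd (differentiableAt_const _)]
      simp
  rw [key, key]
  exact (hc.isSymmSndFDerivAt (by
    simpa using (WithTop.coe_le_coe.2 le_top : ((2 : ℕ∞) : WithTop ℕ∞) ≤ ∞))) _ _

/-- The partial derivative, as a derivation of the algebra of smooth functions on `U`. -/
def partialD {U : Set (Model n)} (hU : IsOpen U) (i : Fin n) :
    Derivation ℝ (smoothOn U) (smoothOn U) :=
  Derivation.mk'
    { toFun := fun a => restrictSmooth (pd i (extendZero a.1)) (contDiffOn_pd hU a.2 i)
      map_add' := fun a b => smoothOn_ext fun y => by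
        have h1 : ∀ z : U, extendZero (a + b).1 z = (extendZero a.1 + extendZero b.1) z := by
          simp
        have h2 := fderiv_add (smoothOn_differentiableAt hU a y)
          (smoothOn_differentiableAt hU b y)
        simp only [map_add, evalAt_restrictSmooth]
        rw [pd_congr hU h1, pd, h2]
        rfl
      map_smul' := fun r a => smoothOn_ext fun y => by
        have h1 : ∀ z : U, extendZero (r • a).1 z = (r • extendZero a.1) z := by simp
        have h2 := fderiv_const_smul (smoothOn_differentiableAt hU a y) r
        simp only [map_smul, evalAt_restrictSmooth, RingHom.id_apply]
        rw [pd_congr hU h1, pd, h2]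
        rfl }
    fun a b => smoothOn_ext fun y => by
      have h1 : ∀ z : U, extendZero (a * b).1 z = (extendZero a.1 * extendZero b.1) z := by simp
      have h2 := fderiv_mul (smoothOn_differentiableAt hU a y)
        (smoothOn_differentiableAt hU b y)
      simp only [map_add, map_mul, smul_eq_mul, LinearMap.coe_mk, AddHom.coe_mk,
        evalAt_restrictSmooth]
      rw [pd_congr hU h1, pd, h2]
      simp only [_root_.add_apply, _root_.smul_apply, smul_eq_mul,
        extendZero_coe]
      rfl

theorem evalAt_partialD {U : Set (Model n)} (hU : IsOpen U) (i : Fin n) (a : smoothOn U)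
    (y : U) : evalAt y (partialD hU i a) = pd i (extendZero a.1) y := rfl

/-- `a` represents the function `u` on `U`. -/
def Represents {U : Set (Model n)} (a : smoothOn U) (u : Model n → ℝ) : Prop :=
  ∀ y : U, u y = evalAt y a

theorem Represents.pd {U : Set (Model n)} (hU : IsOpen U) {a : smoothOn U} {u : Model n → ℝ}
    (h : Represents a u) (i : Fin n) : Represents (partialD hU i a) (pd i u) := fun y => by
  rw [evalAt_partialD hU i a]
  refine pd_congr hU (fun z => ?_) i y
  rw [h z, extendZero_coe]
  rfl

theorem represents_extendZero {U : Set (Model n)} (a : smoothOn U) :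
    Represents a (extendZero a.1) := fun y => extendZero_coe _ y

theorem partialD_comm {U : Set (Model n)} (hU : IsOpen U) (i j : Fin n) (a : smoothOn U) :
    partialD hU i (partialD hU j a) = partialD hU j (partialD hU i a) :=
  smoothOn_ext fun y => by
    have h := represents_extendZero a
    rw [← ((h.pd hU j).pd hU i) y, ← ((h.pd hU i).pd hU j) y, pd_comm hU a.2]

/-! ### Evaluation turns the algebraic tensors into the coordinate ones. -/

variable {U : Set (Model n)} (hU : IsOpen U) {G : Model n → Matrix (Fin n) (Fin n) ℝ}
  {g h : Matrix (Fin n) (Fin n) (smoothOn U)}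

theorem represents_christoffel (hg : ∀ i j, Represents (g i j) fun y => G y i j)
    (hh : ∀ i j, Represents (h i j) fun y => (G y)⁻¹ i j) (k i j : Fin n) :
    Represents (christoffelMatrix (partialD hU) g h i k j) (christoffel G k i j) := by
  intro y
  simp only [christoffel, christoffelMatrix, Matrix.of_apply, map_smul, map_sum, map_mul,
    map_add, map_sub, smul_eq_mul]
  simp only [← hh _ _ y, ← (hg _ _).pd hU _ y]

theorem represents_ricci (hg : ∀ i j, Represents (g i j) fun y => G y i j)
    (hh : ∀ i j, Represents (h i j) fun y => (G y)⁻¹ i j) (i j : Fin n) :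
    Represents (ric (partialD hU) (christoffelMatrix (partialD hU) g h) i j)
      (coordRicci G i j) := by
  intro y
  have hc := represents_christoffel hU hg hh
  simp only [coordRicci, ric, curv, Matrix.of_apply, Matrix.sub_apply, Matrix.add_apply,
    Matrix.mul_apply, matD_apply, map_sum, map_add, map_sub, map_mul]
  simp only [← hc _ _ _ y, ← (hc _ _ _).pd hU _ y, Finset.sum_add_distrib,
    Finset.sum_sub_distrib]
  ring

theorem represents_hess (hg : ∀ i j, Represents (g i j) fun y => G y i j)
    (hh : ∀ i j, Represents (h i j) fun y => (G y)⁻¹ i j) {a : smoothOn U} {u : Model n → ℝ}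
    (ha : Represents a u) (i j : Fin n) :
    Represents (hessMatrix (partialD hU) (christoffelMatrix (partialD hU) g h) a i j)
      (coordHess G u i j) := by
  intro y
  simp only [coordHess, coordNabla, hessMatrix, Matrix.of_apply, map_sum, map_sub, map_mul]
  simp only [← represents_christoffel hU hg hh _ _ _ y, ← ha.pd hU _ y,
    ← (ha.pd hU _).pd hU _ y]

theorem represents_laplacian (hg : ∀ i j, Represents (g i j) fun y => G y i j)
    (hh : ∀ i j, Represents (h i j) fun y => (G y)⁻¹ i j) {a : smoothOn U} {u : Model n → ℝ}
    (ha : Represents a u) :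
    Represents
      (contr h (hessMatrix (partialD hU) (christoffelMatrix (partialD hU) g h) a))
      (coordLaplacian G u) := by
  intro y
  have e : ∀ i j, coordNabla G (fun k => EtaRicci.pd k u) i j y = coordHess G u i j y :=
    fun _ _ => rfl
  simp only [coordLaplacian, coordDiv, contr, map_sum, map_mul, e,
    represents_hess hU hg hh ha _ _ y, ← hh _ _ y]

/-- A symmetric matrix of smooth functions that is invertible on `U` has a smooth inverse. -/
theorem exists_represents_inv (hG : ∀ i j, ContDiffOn ℝ ∞ (fun y => G y i j) U)
    (hsym : ∀ y ∈ U, ∀ i j, G y i j = G y j i) (hdet : ∀ y ∈ U, IsUnit (G y).det) :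
    ∃ g h : Matrix (Fin n) (Fin n) (smoothOn U),
      (∀ i j, Represents (g i j) fun y => G y i j) ∧
      (∀ i j, Represents (h i j) fun y => (G y)⁻¹ i j) ∧
      (∀ i j, g i j = g j i) ∧ (∀ i j, h i j = h j i) ∧ g * h = 1 := by
  let g : Matrix (Fin n) (Fin n) (smoothOn U) := Matrix.of fun i j =>
    restrictSmooth (fun y => G y i j) (hG i j)
  have hev : ∀ y : U, g.map (evalAt y) = G y := fun y => rfl
  have hgs : g.transpose = g :=
    Matrix.ext fun i j => smoothOn_ext fun y => hsym y y.2 j i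
  have hdety : ∀ y : U, evalAt y g.det ≠ 0 := fun y => by
    rw [AlgHom.map_det, AlgHom.mapMatrix_apply, hev]
    exact (hdet y y.2).ne_zero
  -- A smooth function without zeros on `U` has a smooth reciprocal, hence is a unit of the algebra.
  have hunit : IsUnit g.det := by
    refine IsUnit.of_mul_eq_one (restrictSmooth (fun y => (extendZero g.det.1 y)⁻¹)
      (ContDiffOn.inv g.det.2 fun y hy => ?_)) (smoothOn_ext fun y => ?_)
    · rw [represents_extendZero g.det ⟨y, hy⟩]
      exact hdety ⟨y, hy⟩
    · rw [map_mul, evalAt_restrictSmooth, extendZero_coe, map_one]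
      exact mul_inv_cancel₀ (hdety y)
  have hgh : g * g⁻¹ = 1 := Matrix.mul_nonsing_inv g hunit
  refine ⟨g, g⁻¹, fun i j y => rfl, fun i j y => ?_, fun i j => ?_, fun i j => ?_, hgh⟩
  · have h1 : G y * g⁻¹.map (evalAt y) = 1 := by
      have := congrArg (fun T : Matrix (Fin n) (Fin n) (smoothOn U) => T.map (evalAt y)) hgh
      simpa [Matrix.map_mul, hev] using this
    change (G y)⁻¹ i j = g⁻¹.map (evalAt y) i j
    rw [Matrix.inv_eq_right_inv h1]
  · conv_lhs => rw [← hgs]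
    rfl
  · have : (g⁻¹).transpose = g⁻¹ := by rw [Matrix.transpose_nonsing_inv, hgs]
    conv_lhs => rw [← this]
    rfl

/-- The identity for gradient `η`-Ricci solitons with harmonic potential, in a coordinate
domain `U`. -/
theorem coord_soliton_identity (hU : IsOpen U)
    (hG : ∀ i j, ContDiffOn ℝ ∞ (fun y => G y i j) U)
    (hsym : ∀ y ∈ U, ∀ i j, G y i j = G y j i) (hdet : ∀ y ∈ U, IsUnit (G y).det)
    {φ : Model n → ℝ} (hφ : ContDiffOn ℝ ∞ φ U) {X : Fin n → Model n → ℝ}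
    (hX : ∀ k, ∀ y ∈ U, X k y = ∑ l, (G y)⁻¹ k l * pd l φ y) {lam mu : ℝ}
    (hsol : ∀ y ∈ U, ∀ i j, coordLieMetric G X i j y + 2 * coordRicci G i j y +
      2 * lam * G y i j + 2 * mu * (pd i φ y * pd j φ y) = 0)
    (hharm : ∀ y ∈ U, coordLaplacian G φ y = 0) {w : Model n → ℝ}
    (hw : ∀ y ∈ U, w y = ∑ k, X k y * pd k φ y) :
    ContDiffOn ℝ ∞ w U ∧ ∀ y ∈ U,
      (1 / 2) * (coordLaplacian G w y - ∑ k, X k y * pd k w y) =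
        coordTensorNormSq (G y) (fun i j => coordHess G φ i j y) + lam * w y + mu * w y ^ 2 := by
  obtain ⟨g, h, hg, hh, hgs, hhs, hgh⟩ := exists_represents_inv hG hsym hdet
  let f : smoothOn U := restrictSmooth φ hφ
  have hf : Represents f φ := fun _ => rfl
  have hD := partialD_comm hU
  set D := partialD hU with hDdef
  set Γ := christoffelMatrix D g h with hΓ
  have hDf : ∀ k, Represents (D k f) (pd k φ) := fun k => hf.pd hU k
  let x : Fin n → smoothOn U := fun k => ∑ l, h k l * D l f
  have hx : ∀ k, Represents (x k) (X k) := fun k y => by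
    simp only [x, hX k y y.2, map_sum, map_mul, ← hh _ _ y, ← hDf _ y]
  set u := gradNormSq D h f with hu
  have hux : u = ∑ k, x k * D k f := by
    simp only [hu, gradNormSq, contr, Matrix.of_apply, x, Finset.sum_mul]
    rw [Finset.sum_comm]
    refine Finset.sum_congr rfl fun i _ => Finset.sum_congr rfl fun j _ => ?_
    rw [hhs]
    ring
  have huw : Represents u w := fun y => by
    simp only [hw y y.2, hux, map_sum, map_mul, ← hx _ y, ← hDf _ y]
  have hharm' : contr h (hessMatrix D Γ f) = 0 := smoothOn_ext fun y => by
    rw [← represents_laplacian hU hg hh hf y, hharm y y.2, map_zero]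
  have hsol' : hessMatrix D Γ f + ric D Γ + lam • g +
      mu • (Matrix.of fun i j => D i f * D j f) = 0 := by
    refine Matrix.ext fun i j => smoothOn_ext fun y => ?_
    have h1 := hsol y y.2 i j
    have h2 := congrArg (evalAt y) (lie_metric_grad D hD g h hgs hgh hhs f x (fun _ => rfl) i j)
    have h3 : evalAt y (∑ k, (x k * D k (g i j) + g k j * D i (x k) + g i k * D j (x k))) =
        coordLieMetric G X i j y := by
      simp only [coordLieMetric, map_sum, map_add, map_mul, ← hx _ y, ← hg _ _ y,
        ← (hx _).pd hU _ y, ← (hg _ _).pd hU _ y, hDdef]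
    rw [h3, map_mul, map_ofNat] at h2
    rw [h2] at h1
    simp only [Matrix.add_apply, Matrix.smul_apply, Matrix.of_apply, map_add, map_smul, map_mul,
      smul_eq_mul, Matrix.zero_apply, map_zero, ← represents_ricci hU hg hh i j y, ← hg i j y,
      hΓ, hDdef]
    have h4 : ∀ k, evalAt y (partialD hU k f) = pd k φ y := fun k => (hDf k y).symm
    rw [hDdef] at h1
    simp only [h4]
    linear_combination h1 / 2
  refine ⟨?_, fun y hy => ?_⟩
  -- Smoothness of `w` comes from its agreement on `U` with the element `u` of the algebra.
  · exact u.2.congr fun y hy =>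
      (huw ⟨y, hy⟩).trans (represents_extendZero u ⟨y, hy⟩).symm
  · have key := congrArg (evalAt ⟨y, hy⟩)
      (soliton_identity D hD g h hgs hgh hhs f lam mu Γ hΓ hharm' hsol')
    rw [map_sub, represents_laplacian hU hg hh huw ⟨y, hy⟩ |>.symm] at key
    have h1 : evalAt ⟨y, hy⟩ (∑ m, D m u * ∑ l, h m l * D l f) = ∑ k, X k y * pd k w y := by
      simp only [map_sum (g := evalAt ⟨y, hy⟩) (f := fun m => D m u * ∑ l, h m l * D l f), map_mul]
      refine Finset.sum_congr rfl fun k _ => ?_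
      rw [mul_comm, hx k ⟨y, hy⟩, huw.pd hU k ⟨y, hy⟩]
    have h2 : evalAt ⟨y, hy⟩ (contr h (hessMatrix D Γ f * h * (hessMatrix D Γ f).transpose)) =
        coordTensorNormSq (G y) (fun i j => coordHess G φ i j y) := by
      simp only [contr, Matrix.mul_apply, Matrix.transpose_apply, map_sum, map_mul,
        Finset.sum_mul, Finset.mul_sum, coordTensorNormSq,
        represents_hess hU hg hh hf _ _ ⟨y, hy⟩, hh _ _ ⟨y, hy⟩]
      refine Finset.sum_congr rfl fun i _ => ?_
      rw [Finset.sum_comm_cycle]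
      refine Finset.sum_congr rfl fun p _ => Finset.sum_congr rfl fun j _ =>
        Finset.sum_congr rfl fun q _ => ?_
      ring
    rw [h1, ← hu] at key
    simp only [map_mul, map_add, map_ofNat, map_smul, map_pow, smul_eq_mul, h2] at key
    rw [← huw ⟨y, hy⟩] at key
    linear_combination key / 2

end SmoothFunctions

/-! ### Charts: frames, components and the metric matrix. -/

section ManifoldCoordinates

variable {n : ℕ} {M : Type*} [TopologicalSpace M] [ChartedSpace (Model n) M]
  {e : OpenPartialHomeomorph M (Model n)}

theorem mfderiv_symm_eq_sum (v y : Model n) :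
    mfderiv (𝓡 n) (𝓡 n) e.symm y v = ∑ k, v k • frame e k y := by
  have h : v = ∑ k, v k • (EuclideanSpace.single k (1 : ℝ) : Model n) := by
    ext i
    simp [Finset.sum_apply, Pi.single_apply]
  conv_lhs => rw [h]
  exact (map_sum (mfderiv (𝓡 n) (𝓡 n) e.symm y) _ _).trans
    (Finset.sum_congr rfl fun k _ => map_smul _ _ _)

theorem mdifferentiable_of_mem_maximalAtlas (he : e ∈ IsManifold.maximalAtlas (𝓡 n) ∞ M) :
    e.MDifferentiable (𝓡 n) (𝓡 n) :=
  ⟨(contMDiffOn_of_mem_maximalAtlas he).mdifferentiableOn (by simp),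
    (contMDiffOn_symm_of_mem_maximalAtlas he).mdifferentiableOn (by simp)⟩

/-- A tangent vector is the combination of the coordinate vectors with its components. -/
theorem eq_sum_fieldIn_smul_frame (he : e ∈ IsManifold.maximalAtlas (𝓡 n) ∞ M)
    (ξ : ∀ p : M, TangentSpace (𝓡 n) p) {y : Model n} (hy : y ∈ e.target) :
    ξ (e.symm y) = ∑ k, fieldIn ξ e k y • frame e k y := by
  have hd := mdifferentiable_of_mem_maximalAtlas he
  have h1 := hd.symm_comp_deriv (e.map_target hy)
  rw [e.right_inv hy] at h1
  have h2 := DFunLike.congr_fun h1 (ξ (e.symm y))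
  set v : Model n := mfderiv (𝓡 n) (𝓡 n) e (e.symm y) (ξ (e.symm y)) with hv
  have h4 : ξ (e.symm y) = mfderiv (𝓡 n) (𝓡 n) e.symm y v := h2.symm
  rw [h4, mfderiv_symm_eq_sum]
  rfl

/-- The derivative of `e` is a left inverse of that of `e.symm`, so it recovers the coefficients. -/
theorem frame_linearIndependent (he : e ∈ IsManifold.maximalAtlas (𝓡 n) ∞ M)
    {y : Model n} (hy : y ∈ e.target) (c : Fin n → ℝ) (hc : ∑ k, c k • frame e k y = 0) :
    c = 0 := by
  have hd := mdifferentiable_of_mem_maximalAtlas he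
  have h1 := hd.comp_symm_deriv hy
  let v : Model n := WithLp.toLp 2 c
  have h5 : mfderiv (𝓡 n) (𝓡 n) e.symm y v = ∑ k, c k • frame e k y :=
    mfderiv_symm_eq_sum v y
  have h2 : mfderiv (𝓡 n) (𝓡 n) e (e.symm y) (mfderiv (𝓡 n) (𝓡 n) e.symm y v) = v :=
    DFunLike.congr_fun h1 v
  rw [h5, hc, map_zero] at h2
  funext k
  exact (congrArg (fun w : Model n => w k) h2).symm

/-- The components of `du` are the partial derivatives of `u` in coordinates. -/
theorem formIn_differential (he : e ∈ IsManifold.maximalAtlas (𝓡 n) ∞ M) {u : M → ℝ}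
    {y : Model n} (hy : y ∈ e.target)
    (hu : MDifferentiableAt (𝓡 n) 𝓘(ℝ, ℝ) u (e.symm y)) (i : Fin n) :
    formIn (differential u) e i y = pd i (u ∘ e.symm) y := by
  have hd := (mdifferentiable_of_mem_maximalAtlas he).mdifferentiableAt_symm hy
  have h1 := mfderiv_comp y hu hd
  rw [pd, ← mfderiv_eq_fderiv, h1]
  rfl

/-- Needed for `|grad f|²`: the gradient is defined pointwise, so its smoothness is known only
through the coordinate expression. -/
theorem mdifferentiableAt_of_contDiffOn_comp_symm
    (he : e ∈ IsManifold.maximalAtlas (𝓡 n) ∞ M) {u : M → ℝ}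
    (hu : ContDiffOn ℝ ∞ (u ∘ e.symm) e.target) {p : M} (hp : p ∈ e.source) :
    MDifferentiableAt (𝓡 n) 𝓘(ℝ, ℝ) u p := by
  have h1 : MDifferentiableAt (𝓡 n) 𝓘(ℝ, ℝ) (u ∘ e.symm) (e p) :=
    ((hu.contDiffAt (e.open_target.mem_nhds (e.map_source hp))).differentiableAt
      (by simp)).mdifferentiableAt
  have h2 := h1.comp p ((mdifferentiable_of_mem_maximalAtlas he).mdifferentiableAt hp)
  refine h2.congr_of_eventuallyEq ?_
  filter_upwards [e.open_source.mem_nhds hp] with q hq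
  simp [e.left_inv hq]

theorem form_apply_eq_sum (he : e ∈ IsManifold.maximalAtlas (𝓡 n) ∞ M)
    (γ : ∀ p : M, TangentSpace (𝓡 n) p →L[ℝ] ℝ) (ξ : ∀ p : M, TangentSpace (𝓡 n) p)
    {y : Model n} (hy : y ∈ e.target) :
    γ (e.symm y) (ξ (e.symm y)) = ∑ k, fieldIn ξ e k y * formIn γ e k y := by
  rw [eq_sum_fieldIn_smul_frame he ξ hy, map_sum]
  exact Finset.sum_congr rfl fun k _ => by rw [map_smul, smul_eq_mul]; rfl

variable [IsManifold (𝓡 n) ∞ M]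

/-- The frame is the tangent map of `e.symm` applied to a constant vector field. -/
theorem contMDiffOn_frame (he : e ∈ IsManifold.maximalAtlas (𝓡 n) ∞ M) (i : Fin n) :
    ContMDiffOn (𝓡 n) (𝓡 n).tangent ∞
      (fun y => (⟨e.symm y, frame e i y⟩ : TangentBundle (𝓡 n) M)) e.target := by
  have h1 := (contMDiffOn_symm_of_mem_maximalAtlas he).contMDiffOn_tangentMapWithin (m := ∞)
    (by simp) e.open_target.uniqueMDiffOn
  have h2 : ContMDiff (𝓡 n) (𝓡 n).tangent ∞
      (fun y : Model n => (⟨y, (EuclideanSpace.single i (1 : ℝ) : Model n)⟩ :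
        TangentBundle (𝓡 n) (Model n))) :=
    contMDiff_vectorSpace_iff_contDiff.2 contDiff_const
  refine (h1.comp h2.contMDiffOn fun y hy => hy).congr fun y hy => ?_
  simp only [Function.comp_apply, tangentMapWithin, frame]
  rw [mfderivWithin_of_isOpen e.open_target hy]

theorem contDiffOn_metricIn (g : Metric n M) (he : e ∈ IsManifold.maximalAtlas (𝓡 n) ∞ M)
    (i j : Fin n) : ContDiffOn ℝ ∞ (fun y => metricIn g e y i j) e.target := by
  rw [← contMDiffOn_iff_contDiffOn]
  have hψ := g.contMDiff.comp_contMDiffOn (contMDiffOn_symm_of_mem_maximalAtlas he)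
  intro y hy
  have := ContMDiffWithinAt.clm_bundle_apply₂ (F₁ := Model n) (F₂ := Model n)
    (E₁ := fun p : M => TangentSpace (𝓡 n) p) (E₂ := fun p : M => TangentSpace (𝓡 n) p)
    (F₃ := ℝ) (E₃ := fun _ => ℝ) (hψ y hy) (contMDiffOn_frame he i y hy)
    (contMDiffOn_frame he j y hy)
  rw [Bundle.contMDiffWithinAt_totalSpace] at this
  exact this.2

theorem metricIn_symm (g : Metric n M) (y : Model n) (i j : Fin n) :
    metricIn g e y i j = metricIn g e y j i := g.symm _ _ _

/-- A kernel vector of the matrix gives a tangent vector orthogonal to the whole frame, hence to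
itself; positivity makes it zero and independence of the frame kills its coefficients. -/
theorem isUnit_det_metricIn (g : Metric n M) (he : e ∈ IsManifold.maximalAtlas (𝓡 n) ∞ M)
    {y : Model n} (hy : y ∈ e.target) : IsUnit (metricIn g e y).det := by
  rw [isUnit_iff_ne_zero]
  intro hdet
  obtain ⟨c, hc0, hc⟩ := Matrix.exists_mulVec_eq_zero_iff.2 hdet
  refine hc0 (frame_linearIndependent he hy c ?_)
  by_contra hne
  refine (g.pos _ _ hne).ne' ?_
  have h1 : ∀ i, g.inner (e.symm y) (frame e i y) (∑ k, c k • frame e k y) = 0 := fun i => by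
    have := congrFun hc i
    simp only [Matrix.mulVec, dotProduct, metricIn, Matrix.of_apply, Pi.zero_apply] at this
    rw [← this, map_sum]
    exact Finset.sum_congr rfl fun k _ => by rw [map_smul, smul_eq_mul, mul_comm]
  rw [g.symm, map_sum]
  refine Finset.sum_eq_zero fun k _ => ?_
  rw [map_smul, g.symm, h1, smul_zero]

/-- The musical isomorphism in coordinates: `ξ^k = g^kl (ξ^♭)_l`. -/
theorem fieldIn_eq_sum (g : Metric n M) (he : e ∈ IsManifold.maximalAtlas (𝓡 n) ∞ M)
    (ξ : ∀ p : M, TangentSpace (𝓡 n) p) {y : Model n} (hy : y ∈ e.target) (k : Fin n) :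
    fieldIn ξ e k y = ∑ l, (metricIn g e y)⁻¹ k l * formIn (flat g ξ) e l y := by
  have h1 : (metricIn g e y).mulVec (fun k => fieldIn ξ e k y) =
      fun l => formIn (flat g ξ) e l y := by
    funext l
    simp only [formIn, flat, Matrix.mulVec, dotProduct, metricIn, Matrix.of_apply]
    rw [g.symm]
    conv_rhs => rw [eq_sum_fieldIn_smul_frame he ξ hy, map_sum]
    exact Finset.sum_congr rfl fun k _ => by rw [map_smul, smul_eq_mul, mul_comm]
  have h2 := congrArg (metricIn g e y)⁻¹.mulVec h1
  rw [Matrix.mulVec_mulVec, Matrix.nonsing_inv_mul _ (isUnit_det_metricIn g he hy),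
    Matrix.one_mulVec] at h2
  exact congrFun h2 k

end ManifoldCoordinates

end EtaRicci

end

/-! ### Transfer to the manifold. -/

theorem mainTheorem7 (n : ℕ) (M : Type*) [TopologicalSpace M]
    [ChartedSpace (EtaRicci.Model n) M] [IsManifold (𝓡 n) ∞ M]
    (g : EtaRicci.Metric n M) (f : M → ℝ) (hf : ContMDiff (𝓡 n) 𝓘(ℝ, ℝ) ∞ f) (lam mu : ℝ)
    (hsoliton : EtaRicci.IsEtaRicciSoliton g (EtaRicci.grad g f) lam mu)
    (hharmonic : EtaRicci.IsHarmonicForm g (EtaRicci.flat g (EtaRicci.grad g f))) :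
    ∀ e ∈ IsManifold.maximalAtlas (𝓡 n) ∞ M, ∀ p ∈ e.source,
      (1 / 2) * EtaRicci.weightedLaplacian g f e (EtaRicci.normSq g (EtaRicci.grad g f)) p =
        EtaRicci.hessNormSq g e f p + lam * EtaRicci.normSq g (EtaRicci.grad g f) p +
          mu * EtaRicci.normSq g (EtaRicci.grad g f) p ^ 2 := by
  intro e he p hp
  open EtaRicci in
  have hform : ∀ i, ∀ y ∈ e.target,
      formIn (flat g (grad g f)) e i y = pd i (f ∘ e.symm) y := fun i y hy => by
    rw [flat_grad, formIn_differential he hy (hf.mdifferentiableAt (by simp))]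
  open EtaRicci in
  have hφ : ContDiffOn ℝ ∞ (f ∘ e.symm) e.target :=
    contMDiffOn_iff_contDiffOn.1 (hf.comp_contMDiffOn (contMDiffOn_symm_of_mem_maximalAtlas he))
  open EtaRicci in
  have hcoord := coord_soliton_identity e.open_target (contDiffOn_metricIn g he)
    (fun y _ => metricIn_symm g y) (fun y hy => isUnit_det_metricIn g he hy) hφ
    (X := fieldIn (grad g f) e) (lam := lam) (mu := mu)
    (w := normSq g (grad g f) ∘ e.symm)
    (fun k y hy => by
      rw [fieldIn_eq_sum g he _ hy]
      exact Finset.sum_congr rfl fun l _ => by rw [hform l y hy])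
    (fun y hy i j => by
      rw [← hform i y hy, ← hform j y hy]
      exact hsoliton e he y hy i j)
    (fun y hy => by
      rw [← (hharmonic e he y hy).2]
      simp only [coordLaplacian, coordDiv, coordNabla]
      -- The components of `η` equal `∂_j f` on the whole open target, so their derivatives agree
      -- too and `div η` is `Δf`.
      have h1 : ∀ i j, pd i (formIn (flat g (grad g f)) e j) y = pd i (pd j (f ∘ e.symm)) y :=
        fun i j => pd_congr e.open_target (fun z => hform j z z.2) i ⟨y, hy⟩
      simp only [h1, hform _ y hy])
    (fun y hy => by
      rw [Function.comp_apply, normSq]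
      exact (form_apply_eq_sum he (flat g (grad g f)) (grad g f) hy).trans
        (Finset.sum_congr rfl fun k _ => by rw [hform k y hy]))
  obtain ⟨hw, hid⟩ := hcoord
  have hpt := e.map_source hp
  have key := hid (e p) hpt
  open EtaRicci in
  have hgrad : differential (normSq g (grad g f)) p (grad g f p) =
      ∑ k, fieldIn (grad g f) e k (e p) * pd k (normSq g (grad g f) ∘ e.symm) (e p) := by
    have h1 := form_apply_eq_sum he (differential (normSq g (grad g f))) (grad g f) hpt
    have h2 := mdifferentiableAt_of_contDiffOn_comp_symm he hw hp
    -- The component lemma is stated at points `e.symm y`; here `y = e p`.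
    rw [← e.left_inv hp] at h2
    simp only [formIn_differential he hpt h2] at h1
    rw [e.left_inv hp] at h1
    exact h1
  rw [Function.comp_apply, e.left_inv hp] at key
  rw [EtaRicci.weightedLaplacian, hgrad]
  exact key
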